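/- Let $G=(V,E)$ be a finite connected simple graph with $n$ nodes, $m$ edges, degrees $d_u$ and diameter $\Delta_G$. For the simple random walk on $G$ let $h(s,u)$ be the expected time at which a walk started at $s$ first visits $u$ (so $h(u,u)=0$), let $\pi(u)=d_u/(2m)$, and let $\kappa(G)=\sum_{u\in V}h(s,u)\pi(u)$ be Kemeny's constant, where $s\in V$ is any source node (the value does not depend on $s$; for $n=1$ it is $0$). Fix a landmark node $v\in V$ and a breadth-first-search tree $\mathcal B$ of $G$ with root $v$, that is, a spanning tree of $G$ in which every node has the same distance to $v$ as in $G$. For a spanning tree $T$ of $G$ write $P_T[u]$ for the path from $u$ to $v$ in $T$, regarded as a set of edges $(e_1,e_2)$ directed towards $v$. Put $$\mathrm{ps}_T[w]=\sum_{u\in V}\ \sum_{(e_1,e_2)\in P_T[u],\ e_1=w}\frac{d_u}{2m},$$ $$X_1(T)=\sum_{u\in V}\ \sum_{(e_1,e_2)\in P_{\mathcal B}[u]}d_u\Big(\mathbf 1[(e_1,e_2)\in P_T[u]]-\mathbf 1[(e_2,e_1)\in P_T[u]]\Big),$$ $$X_2(T)=\sum_{u\in V}\ \sum_{(e_1,e_2)\in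 P_{\mathcal B}[u]}d_u\Big(\mathrm{ps}_T[e_1]\,\mathbf 1[(e_1,e_2)\in P_T[u]]-\mathrm{ps}_T[e_2]\,\mathbf 1[(e_2,e_1)\in P_T[u]]\Big).$$ The SpanTree estimator of Kemeny's constant with sample size $\omega$ draws independent uniformly random spanning trees $T_1,\dots,T_\omega$ of $G$ and outputs $$\tilde\kappa(G)=\frac1\omega\sum_{i=1}^{\omega}X_1(T_i)-\frac1\omega\sum_{i=1}^{\omega}X_2(T_i)$$ (read as $0$ if $\omega=0$). **Theorem.** $\kappa(G)$ is finite, and: 1. every sample is bounded: $|X_1(T)-X_2(T)|\le 2m\Delta_G$ for every spanning tree $T$ of $G$; 2. for $\omega\ge1$ the estimator is unbiased: $\mathbb E[\tilde\kappa(G)]=\kappa(G)$; 3. for all real $\epsilon>0$ and $p_f>0$, if $\omega\ge \dfrac{8m^2\Delta_G^2\log(2/p_f)}{\epsilon^2}$, then $\Pr\big[\,|\tilde\kappa(G)-\kappa(G)|\le\epsilon\,\big]\ge 1-p_f$. -/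

import Mathlib

open MeasureTheory ProbabilityTheory
open scoped ENNReal

noncomputable section

namespace KemenySpanTree

variable {V : Type*}

section Kemeny

variable [Fintype V] [DecidableEq V] (G : SimpleGraph V) [DecidableRel G.Adj]

/-- Transition probabilities `P = D⁻¹ A` of the simple random walk on `G`. -/
def transitionProb (x y : V) : ℝ :=
  if G.Adj x y then 1 / (G.degree x : ℝ) else 0

/-- The stationary distribution `π(u) = d_u / (2m)`. -/
def stationary (u : V) : ℝ :=
  (G.degree u : ℝ) / (2 * (G.edgeFinset.card : ℝ))

/-- The probability that the simple random walk `X₀, X₁, …` started from `s` has not visited `u`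
at any of the times `0, 1, …, k`, that is, `Pr[τ_u > k]` for the hitting time
`τ_u = min {t ≥ 0 | X_t = u}`. It is the sum of the probabilities of all trajectories
`x₀ = s, x₁, …, x_k` that avoid `u`. -/
def survivalProb (s u : V) (k : ℕ) : ℝ :=
  ∑ x : Fin (k + 1) → V with x 0 = s ∧ ∀ t, x t ≠ u,
    ∏ t : Fin k, transitionProb G (x t.castSucc) (x t.succ)

/-- The expected hitting time `h(s, u) = E_s[τ_u] = ∑_{k ≥ 0} Pr[τ_u > k]`,
an extended nonnegative real; in particular `h(u, u) = 0`. -/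
def hittingTime (s u : V) : ℝ≥0∞ :=
  ∑' k : ℕ, ENNReal.ofReal (survivalProb G s u k)

/-- Kemeny's constant `κ(G) = ∑_u h(s, u) π(u)`, computed from the source node `s`. -/
def kemeny (s : V) : ℝ≥0∞ :=
  ∑ u, hittingTime G s u * ENNReal.ofReal (stationary G u)

end Kemeny

section Trees

/-- The unique path from `u` to `v` in a tree `T`. -/
def treePath {T : SimpleGraph V} (hT : T.IsTree) (u v : V) : T.Walk u v :=
  (hT.existsUnique_path u v).choose

/-- The directed edges `(e₁, e₂)` of the path from `u` to the root `v` in a tree `T`,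
each directed towards `v`, in the order in which the path traverses them. -/
def pathEdges {T : SimpleGraph V} (hT : T.IsTree) (v u : V) : List (V × V) :=
  (treePath hT u v).darts.map fun e => e.toProd

/-- `B` is a breadth-first-search tree of `G` with root `v`: a spanning tree of `G` in which every
node has the same distance to `v` as in `G`. -/
structure IsBFSTree (G : SimpleGraph V) (v : V) (B : SimpleGraph V) : Prop where
  le : B ≤ G
  isTree : B.IsTree
  dist_eq : ∀ u, B.dist u v = G.dist u v

end Trees

/-- The type of spanning trees of `G`. -/
def SpanningTree {V : Type*} (G : SimpleGraph V) : Type _ :=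
  {T : SimpleGraph V // T ≤ G ∧ T.IsTree}

/-- All sets of spanning trees are measurable. -/
instance {V : Type*} (G : SimpleGraph V) : MeasurableSpace (SpanningTree G) := ⊤

theorem SpanningTree.isTree {V : Type*} {G : SimpleGraph V} (T : SpanningTree G) :
    T.1.IsTree := T.2.2

section Estimator

variable [Fintype V] [DecidableEq V] (G : SimpleGraph V) [DecidableRel G.Adj]

/-- The path support `ps[w]` of the sampled tree `T` rooted at `v`: starting from `0`, for each node
`u` and each edge `(e₁, e₂)` of the path from `u` to `v` in `T`, the entry `ps[e₁]` is increased by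
`d_u / (2m)`. -/
def pathSupport (v : V) (T : SpanningTree G) (w : V) : ℝ :=
  ∑ u : V, ((pathEdges T.isTree v u).map fun e =>
    if e.1 = w then (G.degree u : ℝ) / (2 * (G.edgeFinset.card : ℝ)) else 0).sum

/-- `ω` times the total update of the accumulator `x₁` caused by one sampled tree `T`:
for each node `u` and each edge `(e₁, e₂)` of the path from `u` to `v` in the breadth-first-search
tree `B`, add `d_u` if the path from `u` to `v` in `T` runs through `e₁ → e₂`, and subtract `d_u` if
it runs through `e₂ → e₁`. -/
def sampleX₁ (v : V) {B : SimpleGraph V} (hB : IsBFSTree G v B) (T : SpanningTree G) : ℝ :=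
  ∑ u : V, ((pathEdges hB.isTree v u).map fun e =>
    (if e ∈ pathEdges T.isTree v u then (G.degree u : ℝ) else 0)
      - (if e.swap ∈ pathEdges T.isTree v u then (G.degree u : ℝ) else 0)).sum

/-- `ω` times the total update of the accumulator `x₂` caused by one sampled tree `T`:
as for `x₁`, but the amount is `ps[e₁] * d_u` in the first case, `ps[e₂] * d_u` in the second. -/
def sampleX₂ (v : V) {B : SimpleGraph V} (hB : IsBFSTree G v B) (T : SpanningTree G) : ℝ :=
  ∑ u : V, ((pathEdges hB.isTree v u).map fun e =>
    (if e ∈ pathEdges T.isTree v u then pathSupport G v T e.1 * (G.degree u : ℝ) else 0)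
      - (if e.swap ∈ pathEdges T.isTree v u
          then pathSupport G v T e.2 * (G.degree u : ℝ) else 0)).sum

/-- The output `κ̃(G) = x₁ - x₂` of the spanning tree sampling algorithm with landmark `v` and
breadth-first-search tree `B` when the sampled spanning trees are `T 0, …, T (ω - 1)`. -/
def kemenyEstimate (v : V) {B : SimpleGraph V} (hB : IsBFSTree G v B) {ω : ℕ}
    (T : Fin ω → SpanningTree G) : ℝ :=
  (∑ i, sampleX₁ G v hB (T i) / (ω : ℝ)) - ∑ i, sampleX₂ G v hB (T i) / (ω : ℝ)

end Estimator

end KemenySpanTree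

end

noncomputable section

namespace KemenySpanTree

/-! ### Paths to the root in a tree. -/

section Paths

variable {V : Type*} {T : SimpleGraph V} (hT : T.IsTree)

/-! Everything is expressed through spanning forests with two components. Deleting an edge `(a, b)`
from a spanning tree whose paths from `u` and `w` run through it leaves a forest with `u`, `w`, `a`
on one side and `b`, `v` on the other, and this is reversible (`sum_spanningTree_mem_pathEdges`).
Hence the net number of trees in which both paths use `(a, b)` is a difference of forest counts at
`a` and `b` (`sum_spanningTree_current`): a potential difference, which telescopes along any
reference path, so along the one in `B`. The BFS property serves only to keep this path short.

For `u = w`, each tree path is a unit flow, so the forest count divided by the number τ of spanning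
trees solves the Laplace equation with source `w` and sink `v`. Summing these potentials with
weights `d_w` solves the first-step equations of the hitting time (`forestHittingTime_eq`), and a
remainder estimate shows that the solution is the series of survival probabilities
(`hasSum_survivalProb`).

Write `f w u v` for the number of forests with `w`, `u` together and apart from `v`. Then τ·E[X₁] =
∑ d_u f(u,u,v), and τ·E[X₂] = ∑ d_u π(w) f(w,u,v), because path support records which `w` share an
edge with `u`. As f(u,u,v) − f(w,u,v) = f(w,v,u), the difference is τ times Kemeny's constant from
source `v`; symmetrizing in `u`, `w` shows that the source is irrelevant (`sum_forestCount_source`).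
Boundedness of the samples and Hoeffding's inequality give the error guarantee. -/

theorem treePath_isPath (u v : V) : (treePath hT u v).IsPath :=
  (hT.existsUnique_path u v).choose_spec.1

theorem eq_treePath {u v : V} {p : T.Walk u v} (hp : p.IsPath) : p = treePath hT u v :=
  (hT.existsUnique_path u v).choose_spec.2 p hp

theorem pathEdges_eq_of_isPath {u v : V} {p : T.Walk u v} (hp : p.IsPath) :
    pathEdges hT v u = p.darts.map fun e => e.toProd := by
  rw [pathEdges, ← eq_treePath hT hp]

theorem length_pathEdges (u v : V) : (pathEdges hT v u).length = T.dist u v := by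
  obtain ⟨p, hp, hl⟩ := hT.connected.exists_path_of_dist u v
  rw [pathEdges_eq_of_isPath hT hp]
  simp [hl]

theorem adj_of_mem_pathEdges {u v : V} {e : V × V} (he : e ∈ pathEdges hT v u) :
    T.Adj e.1 e.2 := by
  obtain ⟨d, -, rfl⟩ := List.mem_map.1 he
  exact d.adj

theorem nodup_fst_pathEdges (u v : V) : ((pathEdges hT v u).map Prod.fst).Nodup := by
  have h : (pathEdges hT v u).map Prod.fst = (treePath hT u v).support.dropLast := by
    rw [pathEdges, List.map_map, ← SimpleGraph.Walk.map_fst_darts]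
    rfl
  rw [h]
  exact (treePath_isPath hT u v).support_nodup.sublist (List.dropLast_sublist _)

theorem nodup_pathEdges (u v : V) : (pathEdges hT v u).Nodup :=
  (nodup_fst_pathEdges hT u v).of_map

/-- The path from the start of an edge of a path to the root begins with that edge. -/
theorem pathEdges_eq_cons {u v a b : V} :
    (a, b) ∈ pathEdges hT v u → pathEdges hT v a = (a, b) :: pathEdges hT v b := by
  have key : ∀ {u : V} (p : T.Walk u v), p.IsPath → (a, b) ∈ p.darts.map (fun e => e.toProd) →
      pathEdges hT v a = (a, b) :: pathEdges hT v b := by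
    intro u p
    induction p with
    | nil => simp
    | cons hadj q ih =>
      intro hp hm
      rw [SimpleGraph.Walk.darts_cons, List.map_cons, List.mem_cons] at hm
      rcases hm with hm | hm
      · simp only [Prod.mk.injEq] at hm
        obtain ⟨rfl, rfl⟩ := hm
        rw [pathEdges_eq_of_isPath hT hp, pathEdges_eq_of_isPath hT hp.of_cons]
        simp
      · exact ih hp.of_cons hm
  exact key _ (treePath_isPath hT u v)

/-- All paths to the root leave a given node through the same edge. -/
theorem mem_pathEdges_of_fst_mem {u w v a b : V} (h : (a, b) ∈ pathEdges hT v u)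
    (hw : a ∈ (pathEdges hT v w).map Prod.fst) : (a, b) ∈ pathEdges hT v w := by
  obtain ⟨⟨a', x⟩, hx, rfl⟩ := List.mem_map.1 hw
  have h₁ := pathEdges_eq_cons hT h
  rw [pathEdges_eq_cons hT hx] at h₁
  simp only [List.cons.injEq, Prod.mk.injEq, true_and] at h₁
  rw [← h₁.1]
  exact hx

/-- Replaces path membership by connectivity in the forest left after deleting the edge, the form in
which trees can be compared with forests. Every tree edge is a bridge, so the two halves of the path
cannot meet. -/
theorem mem_pathEdges_iff {u v a b : V} :
    (a, b) ∈ pathEdges hT v u ↔ T.Adj a b ∧ (T.deleteEdges {s(a, b)}).Reachable u a ∧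
      (T.deleteEdges {s(a, b)}).Reachable b v := by
  constructor
  · have key : ∀ {u : V} (p : T.Walk u v), p.IsPath → (a, b) ∈ p.darts.map (fun e => e.toProd) →
        (T.deleteEdges {s(a, b)}).Reachable u a ∧ (T.deleteEdges {s(a, b)}).Reachable b v := by
      intro u p
      induction p with
      | nil => simp
      | cons hadj q ih =>
        rename_i u x v
        intro hp hm
        rw [SimpleGraph.Walk.cons_isPath_iff] at hp
        rw [SimpleGraph.Walk.darts_cons, List.map_cons, List.mem_cons] at hm
        rcases hm with hm | hm
        · simp only [Prod.mk.injEq] at hm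
          obtain ⟨rfl, rfl⟩ := hm
          refine ⟨.refl _, ⟨q.toDeleteEdges _ ?_⟩⟩
          rintro e he rfl
          exact hp.2 (q.fst_mem_support_of_mem_edges he)
        · obtain ⟨h₁, h₂⟩ := ih hp.1 hm
          refine ⟨SimpleGraph.Reachable.trans (SimpleGraph.Adj.reachable ?_) h₁, h₂⟩
          obtain ⟨d, hd, hde⟩ := List.mem_map.1 hm
          have ha : a ∈ q.support := by
            have := q.dart_fst_mem_support_of_mem_darts hd
            rwa [hde] at this
          have hb : b ∈ q.support := by
            have := q.dart_snd_mem_support_of_mem_darts hd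
            rwa [hde] at this
          rw [SimpleGraph.deleteEdges_adj]
          refine ⟨hadj, ?_⟩
          -- Both `a` and `b` lie on the remaining path, which does not return to its starting node,
          -- so the first edge is not the deleted one.
          simp only [Set.mem_singleton_iff, Sym2.eq_iff, not_or, not_and]
          exact ⟨fun h => absurd (h ▸ ha) hp.2, fun h => absurd (h ▸ hb) hp.2⟩
    intro h
    exact ⟨adj_of_mem_pathEdges hT h, key _ (treePath_isPath hT u v) h⟩
  · rintro ⟨hadj, hua, hbv⟩
    have hle := T.deleteEdges_le {s(a, b)}
    obtain ⟨p, hp⟩ := hua.exists_isPath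
    obtain ⟨q, hq⟩ := hbv.exists_isPath
    have hbr : ¬ (T.deleteEdges {s(a, b)}).Reachable a b :=
      SimpleGraph.isBridge_iff.1 (SimpleGraph.isAcyclic_iff_forall_adj_isBridge.1 hT.isAcyclic hadj)
    have hsupp : ∀ {x y z : V} (r : (T.deleteEdges {s(a, b)}).Walk x y), z ∈ r.support →
        (T.deleteEdges {s(a, b)}).Reachable x z := by
      classical
      exact fun r hz => ⟨r.takeUntil _ hz⟩
    have hqa : a ∉ q.support := fun h => hbr (hsupp q h).symm
    have hcons : (SimpleGraph.Walk.cons hadj (q.mapLe hle)).IsPath := by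
      rw [SimpleGraph.Walk.cons_isPath_iff]
      refine ⟨hq.mapLe hle, ?_⟩
      simpa using hqa
    have hpath : ((p.mapLe hle).append (SimpleGraph.Walk.cons hadj (q.mapLe hle))).IsPath := by
      rw [SimpleGraph.Walk.isPath_def, SimpleGraph.Walk.support_append, List.nodup_append]
      refine ⟨(hp.mapLe hle).support_nodup, ?_, ?_⟩
      · simpa using hq.support_nodup
      · intro x hx y hy
        rintro rfl
        simp only [SimpleGraph.Walk.support_cons, List.tail_cons, SimpleGraph.Walk.support_mapLe_eq_support] at hx hy
        exact hbr (((hsupp p hx).symm.trans ⟨p⟩).symm.trans (hsupp q hy).symm)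
    rw [pathEdges_eq_of_isPath hT hpath]
    simp

/-- Telescoping sum along the path to the root. -/
theorem sum_pathEdges_sub (g : V → ℝ) (u v : V) :
    ((pathEdges hT v u).map fun e => g e.1 - g e.2).sum = g u - g v := by
  have key : ∀ {u : V} (p : T.Walk u v),
      ((p.darts.map fun e => e.toProd).map fun e => g e.1 - g e.2).sum = g u - g v := by
    intro u p
    induction p with
    | nil => simp
    | cons hadj q ih =>
      rw [SimpleGraph.Walk.darts_cons, List.map_cons, List.map_cons, List.sum_cons, ih]
      simp
  exact key _

end Paths

/-! ### Deleting and restoring one edge. -/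

section DeleteEdges

variable {V : Type*}

/-- Every node of a tree stays connected to one of the ends of a removed edge. -/
theorem reachable_deleteEdges_or {T : SimpleGraph V} (hT : T.Connected) (a b x : V) :
    (T.deleteEdges {s(a, b)}).Reachable x a ∨ (T.deleteEdges {s(a, b)}).Reachable x b := by
  obtain ⟨p⟩ := hT x a
  induction p with
  | nil => exact .inl .rfl
  | cons hadj q ih =>
    rename_i x y a
    by_cases h : s(x, y) = s(a, b)
    · rw [Sym2.eq_iff] at h
      rcases h with ⟨rfl, -⟩ | ⟨rfl, -⟩
      exacts [.inl .rfl, .inr .rfl]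
    · have hxy : (T.deleteEdges {s(a, b)}).Reachable x y :=
        SimpleGraph.Adj.reachable (by simpa [SimpleGraph.deleteEdges_adj, h] using hadj)
      exact ih.imp hxy.trans hxy.trans

theorem deleteEdges_sup_edge {T : SimpleGraph V} {a b : V} (h : T.Adj a b) :
    T.deleteEdges {s(a, b)} ⊔ SimpleGraph.edge a b = T := by
  ext x y
  simp only [SimpleGraph.sup_adj, SimpleGraph.deleteEdges_adj, SimpleGraph.edge_adj,
    Set.mem_singleton_iff, Sym2.eq_iff]
  constructor
  · rintro (h₁ | ⟨⟨rfl, rfl⟩ | ⟨rfl, rfl⟩, -⟩)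
    exacts [h₁.1, h, h.symm]
  · intro h₁
    have := h₁.ne
    tauto

theorem sup_edge_deleteEdges {F : SimpleGraph V} {a b : V} (h : ¬ F.Adj a b) :
    (F ⊔ SimpleGraph.edge a b).deleteEdges {s(a, b)} = F := by
  ext x y
  simp only [SimpleGraph.sup_adj, SimpleGraph.deleteEdges_adj, SimpleGraph.edge_adj,
    Set.mem_singleton_iff, Sym2.eq_iff]
  constructor
  · tauto
  · intro h₁
    refine ⟨.inl h₁, ?_⟩
    rintro (⟨rfl, rfl⟩ | ⟨rfl, rfl⟩)
    exacts [h h₁, h h₁.symm]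

end DeleteEdges

/-! ### Two-component forests and the current through an edge. -/

section Forests

open scoped Classical

variable {V : Type*} [Fintype V] (G : SimpleGraph V)

instance : Finite (SpanningTree G) := by
  unfold SpanningTree
  infer_instance

instance : Fintype (SpanningTree G) := Fintype.ofFinite _

variable {G} in
theorem card_spanningTree_pos (hG : G.Connected) :
    (0 : ℝ) < Fintype.card (SpanningTree G) := by
  obtain ⟨T, hT, hT'⟩ := hG.exists_isTree_le
  have : Nonempty (SpanningTree G) := ⟨⟨T, hT, hT'⟩⟩
  exact_mod_cast Fintype.card_pos

/-- The spanning forests of `G` with at most two components. -/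
def forests : Finset (SimpleGraph V) :=
  Finset.univ.filter fun F => F ≤ G ∧ F.IsAcyclic ∧
    ∀ a b c, F.Reachable a b ∨ F.Reachable b c ∨ F.Reachable a c

variable {G}

theorem mem_forests {F : SimpleGraph V} : F ∈ forests G ↔ F ≤ G ∧ F.IsAcyclic ∧
    ∀ a b c, F.Reachable a b ∨ F.Reachable b c ∨ F.Reachable a c := by
  simp [forests]

theorem reachable_or_reachable {F : SimpleGraph V} (hF : F ∈ forests G) {w v : V}
    (h : ¬ F.Reachable w v) (x : V) : F.Reachable x w ∨ F.Reachable x v := by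
  rcases (mem_forests.1 hF).2.2 x w v with h₁ | h₁ | h₁
  exacts [.inl h₁, absurd h₁ h, .inr h₁]

theorem deleteEdges_mem_forests {T : SimpleGraph V} (hle : T ≤ G) (hT : T.IsTree) (a b : V) :
    T.deleteEdges {s(a, b)} ∈ forests G := by
  refine mem_forests.2 ⟨(T.deleteEdges_le _).trans hle, hT.isAcyclic.anti (T.deleteEdges_le _), ?_⟩
  intro x y z
  have h := reachable_deleteEdges_or hT.connected a b
  -- Pigeonhole: three nodes on two sides of the deleted edge.
  rcases h x with hx | hx <;> rcases h y with hy | hy <;> rcases h z with hz | hz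
  all_goals
    first
    | exact .inl (hx.trans hy.symm)
    | exact .inr (.inl (hy.trans hz.symm))
    | exact .inr (.inr (hx.trans hz.symm))

theorem isTree_sup_edge {F : SimpleGraph V} (hF : F ∈ forests G) {a b : V}
    (h : ¬ F.Reachable a b) : (F ⊔ SimpleGraph.edge a b).IsTree := by
  have hne : a ≠ b := by
    rintro rfl
    exact h .rfl
  have hab : (F ⊔ SimpleGraph.edge a b).Reachable b a :=
    SimpleGraph.Adj.reachable (by simp [SimpleGraph.edge_adj, hne.symm])
  refine ⟨(SimpleGraph.connected_iff_exists_forall_reachable _).2 ⟨a, fun x => ?_⟩,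
    (mem_forests.1 hF).2.1.sup_edge_of_not_reachable h⟩
  rcases reachable_or_reachable hF h x with hx | hx
  · exact (hx.mono le_sup_left).symm
  · exact ((hx.mono le_sup_left).trans hab).symm

/-- Removing the edge `(a, b)` is a bijection between the spanning trees in which the paths from
`u` and from `w` to the root run through `(a, b)` and the two-component forests which separate
`a`, `u`, `w` from `b` and the root. -/
theorem sum_spanningTree_mem_pathEdges {a b : V} (hab : G.Adj a b) (u w v : V) :
    ∑ T : SpanningTree G, (if (a, b) ∈ pathEdges T.isTree v u ∧ (a, b) ∈ pathEdges T.isTree v w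
        then (1 : ℝ) else 0) =
      ∑ F ∈ forests G, if F.Reachable u a ∧ F.Reachable w a ∧ F.Reachable b v ∧ ¬ F.Reachable a v
        then (1 : ℝ) else 0 := by
  rw [Finset.sum_boole, Finset.sum_boole]
  congr 1
  refine Finset.card_bij (fun T _ => T.1.deleteEdges {s(a, b)}) ?_ ?_ ?_
  · intro T hT
    simp only [Finset.mem_filter, Finset.mem_univ, true_and, mem_pathEdges_iff] at hT ⊢
    refine ⟨deleteEdges_mem_forests T.2.1 T.2.2 a b, hT.1.2.1, hT.2.2.1, hT.1.2.2, fun h => ?_⟩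
    exact SimpleGraph.isBridge_iff.1 (SimpleGraph.isAcyclic_iff_forall_adj_isBridge.1
      T.isTree.isAcyclic hT.1.1) (h.trans hT.1.2.2.symm)
  · intro T hT T' hT' h
    simp only [Finset.mem_filter, Finset.mem_univ, true_and, mem_pathEdges_iff] at hT hT'
    apply Subtype.ext
    rw [← deleteEdges_sup_edge hT.1.1, ← deleteEdges_sup_edge hT'.1.1, h]
  · intro F hF
    simp only [Finset.mem_filter] at hF
    obtain ⟨hF, hu, hw, hb, ha⟩ := hF
    have hnr : ¬ F.Reachable a b := fun h => ha (h.trans hb)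
    have hdel : (F ⊔ SimpleGraph.edge a b).deleteEdges {s(a, b)} = F :=
      sup_edge_deleteEdges fun h => hnr h.reachable
    refine ⟨⟨F ⊔ SimpleGraph.edge a b, sup_le (mem_forests.1 hF).1 ?_, isTree_sup_edge hF hnr⟩,
      ?_, hdel⟩
    · rw [SimpleGraph.edge_le_iff]
      exact .inr hab
    · have hadj : (F ⊔ SimpleGraph.edge a b).Adj a b := by simp [SimpleGraph.edge_adj, hab.ne]
      refine Finset.mem_filter.2 ⟨Finset.mem_univ _, ?_⟩
      simp only [mem_pathEdges_iff, hdel]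
      exact ⟨⟨hadj, hu, hb⟩, hadj, hw, hb⟩

variable (G)

/-- The number of two-component spanning forests of `G` which separate `u`, `w`, `x` from `v`. -/
def forestCount (u w x v : V) : ℝ :=
  ∑ F ∈ forests G, if F.Reachable u w ∧ F.Reachable x w ∧ ¬ F.Reachable w v then 1 else 0

theorem forestCount_root (u w v : V) : forestCount G u w v v = 0 := by
  refine Finset.sum_eq_zero fun F _ => if_neg ?_
  rintro ⟨-, h, h'⟩
  exact h' h.symm

/-- The potential of the common current of `u` and `w`, read at `u` itself, is the potential of the
unit current from `w`. -/
theorem forestCount_self_left (u w v : V) : forestCount G u w u v = forestCount G w w u v := by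
  refine Finset.sum_congr rfl fun F _ => ?_
  congr 1
  have : F.Reachable w w := .rfl
  simp only [eq_iff_iff]
  tauto

theorem forestCount_nonneg (u w x v : V) : 0 ≤ forestCount G u w x v :=
  Finset.sum_nonneg fun F _ => by split_ifs <;> norm_num

variable {G}

/-- Kirchhoff's voltage law for the common current through the edge `(a, b)`. -/
theorem sum_spanningTree_current {a b : V} (hab : G.Adj a b) (u w v : V) :
    ∑ T : SpanningTree G,
      ((if (a, b) ∈ pathEdges T.isTree v u ∧ (a, b) ∈ pathEdges T.isTree v w then (1 : ℝ) else 0)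
        - if (b, a) ∈ pathEdges T.isTree v u ∧ (b, a) ∈ pathEdges T.isTree v w then 1 else 0) =
      forestCount G u w a v - forestCount G u w b v := by
  rw [Finset.sum_sub_distrib, sum_spanningTree_mem_pathEdges hab,
    sum_spanningTree_mem_pathEdges hab.symm, forestCount, forestCount, ← Finset.sum_sub_distrib,
    ← Finset.sum_sub_distrib]
  refine Finset.sum_congr rfl fun F hF => ?_
  by_cases huw : F.Reachable u w
  swap
  · have h : ∀ x, ¬ (F.Reachable u x ∧ F.Reachable w x) := fun x hx => huw (hx.1.trans hx.2.symm)
    have ha := h a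
    have hb := h b
    rw [if_neg (by tauto), if_neg (by tauto), if_neg (by tauto), if_neg (by tauto)]
  by_cases hwv : F.Reachable w v
  · have h : ∀ x, ¬ (F.Reachable w x ∧ ¬ F.Reachable x v) := fun x hx => hx.2 (hx.1.symm.trans hwv)
    have ha := h a
    have hb := h b
    rw [if_neg (by tauto), if_neg (by tauto), if_neg (by tauto), if_neg (by tauto)]
  -- Now `F` has exactly two sides, that of `u`, `w` and that of `v`, so every condition depends
  -- only on the sides of `a` and `b`.
  have h₁ : ∀ x, F.Reachable u x ↔ F.Reachable x w := fun x =>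
    ⟨fun h => h.symm.trans huw, fun h => huw.trans h.symm⟩
  have h₂ : ∀ x, F.Reachable x v ↔ ¬ F.Reachable x w := fun x =>
    ⟨fun h h' => hwv (h'.symm.trans h), fun h => (reachable_or_reachable hF hwv x).resolve_left h⟩
  have h₃ : ∀ x, F.Reachable w x ↔ F.Reachable x w := fun x => SimpleGraph.reachable_comm
  have h₄ : F.Reachable w w := .rfl
  simp only [h₁, h₂, h₃, h₄]
  by_cases ha : F.Reachable a w <;> by_cases hb : F.Reachable b w <;> simp [ha, hb]

end Forests

/-! ### Forest counts as electrical potentials. -/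

section Laplacian

open scoped Classical

variable {V : Type*} [Fintype V] (G : SimpleGraph V)

/-- Kirchhoff's current law for the path from `w` to the root. -/
theorem sum_neighbor_pathEdges (T : SpanningTree G) (a w v : V) :
    ∑ b with G.Adj a b, ((if (a, b) ∈ pathEdges T.isTree v w then (1 : ℝ) else 0)
        - if (b, a) ∈ pathEdges T.isTree v w then 1 else 0) =
      (if w = a then 1 else 0) - if v = a then 1 else 0 := by
  rw [← sum_pathEdges_sub T.isTree (fun x => if x = a then (1 : ℝ) else 0) w v,
    ← List.sum_toFinset _ (nodup_pathEdges T.isTree w v), Finset.sum_sub_distrib,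
    Finset.sum_sub_distrib]
  have hadj : ∀ {e}, e ∈ pathEdges T.isTree v w → G.Adj e.1 e.2 :=
    fun he => T.2.1 (adj_of_mem_pathEdges T.isTree he)
  congr 1
  · rw [Finset.sum_boole, Finset.sum_boole]
    congr 1
    refine Finset.card_bij (fun b _ => (a, b)) ?_ ?_ ?_
    · simp
    · simp
    · rintro ⟨x, y⟩ h
      simp only [Finset.mem_filter, List.mem_toFinset] at h
      obtain ⟨h, rfl⟩ := h
      exact ⟨y, by simpa [h] using hadj h, rfl⟩
  · rw [Finset.sum_boole, Finset.sum_boole]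
    congr 1
    refine Finset.card_bij (fun b _ => (b, a)) ?_ ?_ ?_
    · simp
    · simp
    · rintro ⟨x, y⟩ h
      simp only [Finset.mem_filter, List.mem_toFinset] at h
      obtain ⟨h, rfl⟩ := h
      exact ⟨x, by simpa [h] using (hadj h).symm, rfl⟩

/-- As a function of `a`, the number of forests which separate `a` and `w` from `v` is `τ(G)` times
the electrical potential of the unit current from `w` to `v`. -/
theorem sum_neighbor_forestCount (a w v : V) :
    ∑ b with G.Adj a b, (forestCount G w w a v - forestCount G w w b v) =
      (Fintype.card (SpanningTree G) : ℝ) * ((if w = a then 1 else 0) - if v = a then 1 else 0) := by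
  calc _ = ∑ b with G.Adj a b, ∑ T : SpanningTree G,
        ((if (a, b) ∈ pathEdges T.isTree v w then (1 : ℝ) else 0)
        - if (b, a) ∈ pathEdges T.isTree v w then 1 else 0) := by
        refine Finset.sum_congr rfl fun b hb => ?_
        rw [← sum_spanningTree_current (Finset.mem_filter.1 hb).2]
        simp only [and_self]
    _ = _ := by
        rw [Finset.sum_comm]
        simp only [sum_neighbor_pathEdges, Finset.sum_const, Finset.card_univ, nsmul_eq_mul]

end Laplacian

/-! ### Hitting times as weighted forest counts. -/

section HittingTime

variable {V : Type*} [Fintype V] (G : SimpleGraph V) [DecidableRel G.Adj]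

theorem transitionProb_nonneg (x y : V) : 0 ≤ transitionProb G x y := by
  unfold transitionProb
  split_ifs <;> positivity

theorem stationary_nonneg (u : V) : 0 ≤ stationary G u := by
  unfold stationary
  positivity

/-- The number of spanning forests expression for the expected hitting time. -/
def forestHittingTime (s u : V) : ℝ :=
  ∑ w, (G.degree w : ℝ) * (forestCount G w w s u / Fintype.card (SpanningTree G))

theorem forestHittingTime_nonneg (s u : V) : 0 ≤ forestHittingTime G s u :=
  Finset.sum_nonneg fun w _ => mul_nonneg (Nat.cast_nonneg _)
    (div_nonneg (forestCount_nonneg G w w s u) (Nat.cast_nonneg _))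

theorem forestHittingTime_self (u : V) : forestHittingTime G u u = 0 := by
  simp [forestHittingTime, forestCount_root]

variable [DecidableEq V]

theorem survivalProb_nonneg (s u : V) (k : ℕ) : 0 ≤ survivalProb G s u k :=
  Finset.sum_nonneg fun _ _ => Finset.prod_nonneg fun _ _ => transitionProb_nonneg G _ _

theorem survivalProb_zero (s u : V) : survivalProb G s u 0 = if s = u then 0 else 1 := by
  rw [survivalProb, Finset.sum_filter, ← (Equiv.funUnique (Fin 1) V).symm.sum_comp]
  simp only [Equiv.funUnique_symm_apply, uniqueElim_const, Finset.univ_eq_empty,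
    Finset.prod_empty, forall_const]
  rw [Finset.sum_eq_single s]
  · simp [ite_not]
  · intro b _ hb
    simp [hb]
  · simp

/-- First step decomposition of the survival probability. -/
theorem survivalProb_succ (s u : V) (k : ℕ) : survivalProb G s u (k + 1) =
    if s = u then 0 else ∑ x, transitionProb G s x * survivalProb G x u k := by
  have h : survivalProb G s u (k + 1) = ∑ a : V, ∑ y : Fin (k + 1) → V,
      if a = s ∧ a ≠ u ∧ ∀ t, y t ≠ u then
        transitionProb G a (y 0) * ∏ t : Fin k, transitionProb G (y t.castSucc) (y t.succ)
      else 0 := by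
    rw [survivalProb, Finset.sum_filter, ← (Fin.consEquiv fun _ => V).sum_comp,
      Fintype.sum_prod_type]
    refine Finset.sum_congr rfl fun a _ => Finset.sum_congr rfl fun y _ => ?_
    simp only [Fin.consEquiv_apply, Fin.cons_zero, Fin.forall_fin_succ (n := k + 1), Fin.cons_succ,
      Fin.prod_univ_succ (n := k), Fin.castSucc_zero, ← Fin.succ_castSucc]
  rw [h, Finset.sum_eq_single s]
  · split_ifs with hs
    · simp [hs]
    · simp only [survivalProb, Finset.sum_filter, Finset.mul_sum]
      rw [Finset.sum_comm]
      refine Finset.sum_congr rfl fun y _ => ?_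
      rw [Finset.sum_eq_single (y 0)]
      · simp [hs]
      · intro b _ hb
        simp [hb.symm]
      · simp
  · intro b _ hb
    simp [hb]
  · simp

variable {G}

theorem sum_neighborFinset_forestHittingTime (hG : G.Connected) {s u : V} (hs : s ≠ u) :
    ∑ b ∈ G.neighborFinset s, (forestHittingTime G s u - forestHittingTime G b u) =
      G.degree s := by
  have hτ := card_spanningTree_pos hG
  calc _ = ∑ w, (G.degree w : ℝ) / Fintype.card (SpanningTree G) *
        ∑ b ∈ G.neighborFinset s, (forestCount G w w s u - forestCount G w w b u) := by
        simp only [forestHittingTime, ← Finset.sum_sub_distrib, Finset.mul_sum]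
        rw [Finset.sum_comm]
        refine Finset.sum_congr rfl fun w _ => Finset.sum_congr rfl fun b _ => ?_
        ring
    _ = ∑ w, (G.degree w : ℝ) * if w = s then 1 else 0 := by
        refine Finset.sum_congr rfl fun w _ => ?_
        have h := sum_neighbor_forestCount G s w u
        rw [if_neg hs.symm, sub_zero] at h
        have h' : ∑ b ∈ G.neighborFinset s, (forestCount G w w s u - forestCount G w w b u) =
            Fintype.card (SpanningTree G) * if w = s then 1 else 0 := by
          rw [G.neighborFinset_eq_filter]
          convert h
        rw [h']
        field_simp
    _ = G.degree s := by simp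

/-- First step equation of the expected hitting time. -/
theorem forestHittingTime_eq (hG : G.Connected) {s u : V} (hs : s ≠ u) :
    forestHittingTime G s u = 1 + ∑ x, transitionProb G s x * forestHittingTime G x u := by
  have : Nontrivial V := ⟨s, u, hs⟩
  have hd : (0 : ℝ) < G.degree s := by
    exact_mod_cast hG.preconnected.degree_pos_of_nontrivial s
  have h := sum_neighborFinset_forestHittingTime hG hs
  rw [Finset.sum_sub_distrib, Finset.sum_const, G.card_neighborFinset_eq_degree,
    nsmul_eq_mul] at h
  have h' : ∑ x, transitionProb G s x * forestHittingTime G x u =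
      (∑ x ∈ G.neighborFinset s, forestHittingTime G x u) / G.degree s := by
    rw [G.neighborFinset_eq_filter, Finset.sum_filter, Finset.sum_div]
    refine Finset.sum_congr rfl fun x _ => ?_
    unfold transitionProb
    split_ifs <;> ring
  rw [h']
  field_simp
  linarith

/-- Iterating the first-step equation leaves as remainder the expectation of `forestHittingTime` at
time `k + 1` on the event that `u` is not visited up to time `k`, which is at most `C` times the
probability of that event. -/
theorem sum_range_survivalProb_bounds (hG : G.Connected) {C : ℝ} {u : V}
    (hC : ∀ s, forestHittingTime G s u ≤ C) (k : ℕ) (s : V) :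
    0 ≤ forestHittingTime G s u - ∑ j ∈ Finset.range (k + 1), survivalProb G s u j ∧
      forestHittingTime G s u - ∑ j ∈ Finset.range (k + 1), survivalProb G s u j ≤
        C * survivalProb G s u k := by
  induction k generalizing s with
  | zero =>
    simp only [zero_add, Finset.sum_range_one, survivalProb_zero]
    split_ifs with hs
    · subst hs
      simp [forestHittingTime_self]
    · have h : 0 ≤ ∑ x, transitionProb G s x * forestHittingTime G x u :=
        Finset.sum_nonneg fun x _ =>
          mul_nonneg (transitionProb_nonneg G s x) (forestHittingTime_nonneg G x u)
      have := forestHittingTime_eq hG hs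
      have := hC s
      constructor <;> linarith
  | succ k ih =>
    by_cases hs : s = u
    · subst hs
      have h : ∀ j, survivalProb G s s j = 0 := by
        rintro (_ | j)
        · simp [survivalProb_zero]
        · simp [survivalProb_succ]
      simp [h, forestHittingTime_self]
    · have h : forestHittingTime G s u - ∑ j ∈ Finset.range (k + 2), survivalProb G s u j =
          ∑ x, transitionProb G s x * (forestHittingTime G x u -
            ∑ j ∈ Finset.range (k + 1), survivalProb G x u j) := by
        rw [Finset.sum_range_succ', survivalProb_zero, if_neg hs, forestHittingTime_eq hG hs]
        simp only [survivalProb_succ, if_neg hs, mul_sub, Finset.sum_sub_distrib, Finset.mul_sum]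
        rw [Finset.sum_comm]
        ring
      rw [h]
      refine ⟨Finset.sum_nonneg fun x _ => mul_nonneg (transitionProb_nonneg G s x) (ih x).1, ?_⟩
      rw [survivalProb_succ, if_neg hs, Finset.mul_sum]
      refine Finset.sum_le_sum fun x _ => ?_
      rw [mul_left_comm]
      exact mul_le_mul_of_nonneg_left (ih x).2 (transitionProb_nonneg G s x)

/-- Nonnegative remainders bound the partial sums, so the series converges; its terms then tend to
zero, and so do the remainders. -/
theorem hasSum_survivalProb (hG : G.Connected) (s u : V) :
    HasSum (survivalProb G s u) (forestHittingTime G s u) := by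
  have hC : ∀ x, forestHittingTime G x u ≤ ∑ y, forestHittingTime G y u := fun x =>
    Finset.single_le_sum (f := fun y => forestHittingTime G y u)
      (fun y _ => forestHittingTime_nonneg G y u) (Finset.mem_univ x)
  have hb := fun k => sum_range_survivalProb_bounds hG hC k s
  have hsum : Summable (survivalProb G s u) := by
    refine summable_of_sum_range_le (c := forestHittingTime G s u)
      (survivalProb_nonneg G s u) fun n => ?_
    refine le_trans (Finset.sum_le_sum_of_subset_of_nonneg
      (Finset.range_mono (Nat.le_succ n)) fun j _ _ => survivalProb_nonneg G s u j) ?_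
    linarith [(hb n).1]
  have h₀ : Filter.Tendsto (fun k => forestHittingTime G s u -
      ∑ j ∈ Finset.range (k + 1), survivalProb G s u j) Filter.atTop (nhds 0) := by
    refine squeeze_zero (fun k => (hb k).1) (fun k => (hb k).2) ?_
    simpa using hsum.tendsto_atTop_zero.const_mul (∑ y, forestHittingTime G y u)
  have h₁ := (hsum.hasSum.tendsto_sum_nat.comp (Filter.tendsto_add_atTop_nat 1)).const_sub
    (forestHittingTime G s u)
  have := tendsto_nhds_unique h₀ h₁
  rw [sub_eq_zero.1 this.symm]
  exact hsum.hasSum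

theorem hittingTime_eq (hG : G.Connected) (s u : V) :
    hittingTime G s u = ENNReal.ofReal (forestHittingTime G s u) := by
  have h := hasSum_survivalProb hG s u
  rw [hittingTime, ← ENNReal.ofReal_tsum_of_nonneg (survivalProb_nonneg G s u) h.summable,
    h.tsum_eq]

theorem kemeny_eq (hG : G.Connected) (s : V) :
    kemeny G s = ENNReal.ofReal (∑ u, forestHittingTime G s u * stationary G u) := by
  rw [kemeny, ENNReal.ofReal_sum_of_nonneg fun u _ =>
    mul_nonneg (forestHittingTime_nonneg G s u) (stationary_nonneg G u)]
  refine Finset.sum_congr rfl fun u _ => ?_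
  rw [hittingTime_eq hG, ENNReal.ofReal_mul (forestHittingTime_nonneg G s u)]

theorem kemeny_toReal (hG : G.Connected) (s : V) :
    (kemeny G s).toReal = ∑ u, forestHittingTime G s u * stationary G u := by
  rw [kemeny_eq hG, ENNReal.toReal_ofReal]
  exact Finset.sum_nonneg fun u _ =>
    mul_nonneg (forestHittingTime_nonneg G s u) (stationary_nonneg G u)

end HittingTime

/-! ### Bounds and sums of the samples over all spanning trees. -/

section Samples

theorem sum_map_ite_fst {V : Type*} [DecidableEq V] (w : V) (c : ℝ) :
    ∀ l : List (V × V), (l.map Prod.fst).Nodup →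
      (l.map fun e => if e.1 = w then c else 0).sum = if w ∈ l.map Prod.fst then c else 0
  | [], _ => by simp
  | e :: l, h => by
    rw [List.map_cons, List.nodup_cons] at h
    rw [List.map_cons, List.sum_cons, sum_map_ite_fst w c l h.2, List.map_cons]
    by_cases he : e.1 = w
    · subst he
      simp only [if_true, if_neg h.1, List.mem_cons, true_or, add_zero]
    · simp only [if_neg he, zero_add, List.mem_cons, Ne.symm he, false_or]

theorem list_sum_map_sub {α : Type*} (f g : α → ℝ) (l : List α) :
    (l.map fun e => f e - g e).sum = (l.map f).sum - (l.map g).sum := by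
  induction l with
  | nil => simp
  | cons e l ih =>
    simp only [List.map_cons, List.sum_cons, ih]
    ring

theorem abs_list_sum_map_le {α : Type*} (f : α → ℝ) (c : ℝ) (l : List α)
    (h : ∀ e ∈ l, |f e| ≤ c) : |(l.map f).sum| ≤ l.length * c := by
  induction l with
  | nil => simp
  | cons e l ih =>
    rw [List.map_cons, List.sum_cons, List.length_cons]
    have h₁ := h e (by simp)
    have h₂ := ih fun x hx => h x (by simp [hx])
    have h₃ := abs_add_le (f e) (l.map f).sum
    push_cast
    linarith

theorem sum_list_sum_map {ι α : Type*} (s : Finset ι) (f : ι → α → ℝ) (l : List α) :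
    ∑ i ∈ s, (l.map (f i)).sum = (l.map fun e => ∑ i ∈ s, f i e).sum := by
  induction l with
  | nil => simp
  | cons e l ih => simp [Finset.sum_add_distrib, ih]

theorem length_pathEdges_le_diam {V : Type*} [Finite V] {G B : SimpleGraph V} {v : V}
    (hB : IsBFSTree G v B) (hG : G.Connected) (u : V) :
    ((pathEdges hB.isTree v u).length : ℝ) ≤ G.diam := by
  have : Nonempty V := ⟨v⟩
  rw [length_pathEdges, hB.dist_eq]
  exact_mod_cast SimpleGraph.dist_le_diam (SimpleGraph.connected_iff_ediam_ne_top.1 hG)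

variable {V : Type*} [Fintype V]

theorem sum_stationary_le_one (G : SimpleGraph V) [DecidableRel G.Adj] : ∑ u, stationary G u ≤ 1 := by
  have h : (∑ u, (G.degree u : ℝ)) = 2 * G.edgeFinset.card := by
    exact_mod_cast G.sum_degrees_eq_twice_card_edges
  simp only [stationary, ← Finset.sum_div, h]
  exact div_self_le_one _

variable [DecidableEq V] {G : SimpleGraph V}

/-- The net number of trees in which an edge of the reference path from `u` is on both paths. -/
theorem sum_reference_path {v : V} {B : SimpleGraph V} (hB : IsBFSTree G v B) (u w : V) :
    ∑ T : SpanningTree G, ((pathEdges hB.isTree v u).map fun e =>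
      (if e ∈ pathEdges T.isTree v u ∧ e ∈ pathEdges T.isTree v w then (1 : ℝ) else 0) -
        if e.swap ∈ pathEdges T.isTree v u ∧ e.swap ∈ pathEdges T.isTree v w then 1 else 0).sum =
      forestCount G w w u v := by
  rw [sum_list_sum_map, ← forestCount_self_left]
  have h := sum_pathEdges_sub hB.isTree (fun x => forestCount G u w x v) u v
  rw [forestCount_root, sub_zero] at h
  rw [← h]
  congr 1
  refine List.map_congr_left fun e he => ?_
  rw [← sum_spanningTree_current (hB.le (adj_of_mem_pathEdges hB.isTree he)) u w v]
  refine Finset.sum_congr rfl fun T _ => ?_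
  congr

/-- In a two-component forest separating `u` from `v`, the node `w` lies either with `u` or with
`v`. -/
theorem forestCount_sub_forestCount (u w v : V) :
    forestCount G u u u v - forestCount G w w u v = forestCount G w w v u := by
  classical
  unfold forestCount
  rw [← Finset.sum_sub_distrib]
  refine Finset.sum_congr rfl fun F hF => ?_
  have hu : F.Reachable u u := .rfl
  have hw : F.Reachable w w := .rfl
  have hwu : F.Reachable w u ↔ F.Reachable u w := SimpleGraph.reachable_comm
  have hvw : F.Reachable v w ↔ F.Reachable w v := SimpleGraph.reachable_comm
  simp only [hu, hw, hwu, hvw, true_and]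
  have h₁ : F.Reachable u w → F.Reachable w v → F.Reachable u v := .trans
  have h₂ : F.Reachable u w → F.Reachable u v → F.Reachable w v := fun h => h.symm.trans
  have h₃ : F.Reachable w v → F.Reachable u v → F.Reachable u w := fun h h' => h'.trans h.symm
  have h₄ : ¬ F.Reachable w v → F.Reachable u w ∨ F.Reachable u v :=
    fun h => reachable_or_reachable hF h u
  by_cases a : F.Reachable u w <;> by_cases b : F.Reachable w v <;> by_cases c : F.Reachable u v
  all_goals simp_all

variable (G) [DecidableRel G.Adj]

theorem pathSupport_eq (v : V) (T : SpanningTree G) (w : V) :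
    pathSupport G v T w =
      ∑ u, if w ∈ (pathEdges T.isTree v u).map Prod.fst then stationary G u else 0 :=
  Finset.sum_congr rfl fun u _ => sum_map_ite_fst w _ _ (nodup_fst_pathEdges T.isTree u v)

theorem pathSupport_mem_Icc (v : V) (T : SpanningTree G) (w : V) :
    pathSupport G v T w ∈ Set.Icc 0 1 := by
  rw [pathSupport_eq]
  refine ⟨Finset.sum_nonneg fun u _ => ?_, le_trans (Finset.sum_le_sum fun u _ => ?_)
    (sum_stationary_le_one G)⟩
  all_goals
    have := stationary_nonneg G u
    split_ifs <;> linarith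

/-- If the path from `u` to the root runs through an edge, then the path support of the start of
this edge is the stationary mass of all nodes whose paths run through the edge. -/
theorem ite_pathSupport (v : V) (T : SpanningTree G) (u : V) (e : V × V) (c : ℝ) :
    (if e ∈ pathEdges T.isTree v u then pathSupport G v T e.1 * c else 0) =
      ∑ w, c * stationary G w *
        if e ∈ pathEdges T.isTree v u ∧ e ∈ pathEdges T.isTree v w then 1 else 0 := by
  by_cases he : e ∈ pathEdges T.isTree v u
  swap
  · simp [he]
  rw [if_pos he, pathSupport_eq, Finset.sum_mul]
  refine Finset.sum_congr rfl fun w _ => ?_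
  have h : e.1 ∈ (pathEdges T.isTree v w).map Prod.fst ↔ e ∈ pathEdges T.isTree v w :=
    ⟨mem_pathEdges_of_fst_mem T.isTree he, List.mem_map_of_mem⟩
  simp only [h, he, true_and]
  split_ifs <;> ring

variable {G} {v : V} {B : SimpleGraph V} (hB : IsBFSTree G v B)

theorem abs_sampleX₁_sub_sampleX₂_le (hG : G.Connected) (T : SpanningTree G) :
    |sampleX₁ G v hB T - sampleX₂ G v hB T| ≤ 2 * (G.edgeFinset.card : ℝ) * (G.diam : ℝ) := by
  have hdeg : (∑ u, (G.degree u : ℝ)) = 2 * G.edgeFinset.card := by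
    exact_mod_cast G.sum_degrees_eq_twice_card_edges
  rw [sampleX₁, sampleX₂, ← Finset.sum_sub_distrib, ← hdeg, Finset.sum_mul]
  refine (Finset.abs_sum_le_sum_abs _ _).trans (Finset.sum_le_sum fun u _ => ?_)
  have hd : (0 : ℝ) ≤ G.degree u := Nat.cast_nonneg _
  rw [← list_sum_map_sub]
  refine (abs_list_sum_map_le _ (G.degree u) _ fun e _ => ?_).trans ?_
  · obtain ⟨h₁, h₁'⟩ := pathSupport_mem_Icc G v T e.1
    obtain ⟨h₂, h₂'⟩ := pathSupport_mem_Icc G v T e.2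
    have := mul_nonneg h₁ hd
    have := mul_nonneg h₂ hd
    -- Path supports lie in [0, 1], so subtracting the X₂ term from the X₁ term leaves at most `d_u`
    -- in absolute value per edge.
    have := mul_le_mul_of_nonneg_right h₁' hd
    have := mul_le_mul_of_nonneg_right h₂' hd
    rw [abs_le]
    split_ifs <;> constructor <;> linarith
  · rw [mul_comm]
    exact mul_le_mul_of_nonneg_left (length_pathEdges_le_diam hB hG u) hd

/-- The case `w = u` of `sum_reference_path`; divided by τ, the forest count is the effective
resistance between `u` and `v`. -/
theorem sum_sampleX₁ : ∑ T, sampleX₁ G v hB T = ∑ u, (G.degree u : ℝ) * forestCount G u u u v := by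
  simp only [sampleX₁]
  rw [Finset.sum_comm]
  refine Finset.sum_congr rfl fun u _ => ?_
  rw [← sum_reference_path hB, Finset.mul_sum]
  refine Finset.sum_congr rfl fun T _ => ?_
  rw [← List.sum_map_mul_left]
  congr 1
  refine List.map_congr_left fun e _ => ?_
  simp only [and_self, mul_sub, mul_ite, mul_one, mul_zero]

theorem sum_sampleX₂ : ∑ T, sampleX₂ G v hB T =
    ∑ u, ∑ w, (G.degree u : ℝ) * stationary G w * forestCount G w w u v := by
  simp only [sampleX₂]
  rw [Finset.sum_comm]
  refine Finset.sum_congr rfl fun u _ => ?_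
  simp only [← sum_reference_path hB, Finset.mul_sum]
  rw [Finset.sum_comm]
  refine Finset.sum_congr rfl fun T _ => ?_
  simp only [← List.sum_map_mul_left]
  rw [sum_list_sum_map]
  congr 1
  refine List.map_congr_left fun e _ => ?_
  have h := ite_pathSupport G v T u e.swap (G.degree u)
  rw [Prod.fst_swap] at h
  rw [ite_pathSupport, h, ← Finset.sum_sub_distrib]
  simp only [mul_sub]

/-- The weighted number of two-component forests, from which Kemeny's constant is obtained, does not
depend on the source. -/
theorem sum_forestCount_source (s t : V) :
    ∑ u, ∑ w, (G.degree u : ℝ) * G.degree w * forestCount G w w s u =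
      ∑ u, ∑ w, (G.degree u : ℝ) * G.degree w * forestCount G w w t u := by
  classical
  have key : ∀ s, 2 * ∑ u, ∑ w, (G.degree u : ℝ) * G.degree w * forestCount G w w s u =
      ∑ u, ∑ w, (G.degree u : ℝ) * G.degree w *
        ∑ F ∈ forests G, if F.Reachable u w then 0 else 1 := by
    intro s
    rw [two_mul]
    -- Exchanging `u` and `w` in the second copy lets each forest separating them count exactly
    -- once, since `s` is on exactly one of the two sides.
    nth_rw 2 [Finset.sum_comm]
    rw [← Finset.sum_add_distrib]
    refine Finset.sum_congr rfl fun u _ => ?_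
    rw [← Finset.sum_add_distrib]
    refine Finset.sum_congr rfl fun w _ => ?_
    rw [mul_comm (G.degree w : ℝ), ← mul_add, forestCount, forestCount, ← Finset.sum_add_distrib]
    congr 1
    refine Finset.sum_congr rfl fun F hF => ?_
    have hu : F.Reachable u u := .rfl
    have hw : F.Reachable w w := .rfl
    have hwu : F.Reachable w u ↔ F.Reachable u w := SimpleGraph.reachable_comm
    simp only [hu, hw, hwu, true_and]
    by_cases a : F.Reachable u w
    · simp [a]
    · have h₁ : F.Reachable s u → ¬ F.Reachable s w := fun h h' => a (h.symm.trans h')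
      have h₂ := reachable_or_reachable hF a s
      by_cases b : F.Reachable s u <;> simp_all
  have := key s
  have := key t
  linarith

theorem sum_sampleX₁_sub_sampleX₂ (hG : G.Connected) (s : V) :
    ∑ T, (sampleX₁ G v hB T - sampleX₂ G v hB T) =
      Fintype.card (SpanningTree G) * (kemeny G s).toReal := by
  have hτ := card_spanningTree_pos hG
  have hdeg : (∑ u, (G.degree u : ℝ)) = 2 * G.edgeFinset.card := by
    exact_mod_cast G.sum_degrees_eq_twice_card_edges
  have hk : Fintype.card (SpanningTree G) * (kemeny G s).toReal =
      (∑ u, ∑ w, (G.degree u : ℝ) * G.degree w * forestCount G w w v u) /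
        (2 * G.edgeFinset.card) := by
    rw [← sum_forestCount_source s v, kemeny_toReal hG, Finset.mul_sum, Finset.sum_div]
    refine Finset.sum_congr rfl fun u _ => ?_
    rw [forestHittingTime, stationary, Finset.sum_mul, Finset.mul_sum, Finset.sum_div]
    refine Finset.sum_congr rfl fun w _ => ?_
    field_simp
  rw [hk, Finset.sum_sub_distrib, sum_sampleX₁, sum_sampleX₂]
  -- Without edges the divisions by `2m` are divisions by zero, but all degrees vanish and so do
  -- both sides.
  by_cases hm : (G.edgeFinset.card : ℝ) = 0
  · have h₀ : ∀ u, (G.degree u : ℝ) = 0 := by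
      rw [hm, mul_zero, Finset.sum_eq_zero_iff_of_nonneg fun u _ => Nat.cast_nonneg _] at hdeg
      exact fun u => hdeg u (Finset.mem_univ u)
    simp [h₀]
  · rw [eq_div_iff (by positivity), sub_mul]
    have h : ∀ u w, (G.degree u : ℝ) * G.degree w * forestCount G w w v u =
        G.degree u * G.degree w * forestCount G u u u v -
          G.degree u * G.degree w * forestCount G w w u v := fun u w => by
      rw [← forestCount_sub_forestCount, mul_sub]
    simp only [h, Finset.sum_sub_distrib]
    congr 1
    · rw [Finset.sum_mul]
      refine Finset.sum_congr rfl fun u _ => ?_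
      rw [← hdeg, Finset.mul_sum]
      exact Finset.sum_congr rfl fun w _ => by ring
    · rw [Finset.sum_mul]
      refine Finset.sum_congr rfl fun u _ => ?_
      rw [Finset.sum_mul]
      refine Finset.sum_congr rfl fun w _ => ?_
      rw [stationary]
      field_simp

end Samples

/-! ### Concentration of averages. -/

section Hoeffding

/-- Two-sided Hoeffding bound for the average of independent random variables in `[-c, c]`. -/
theorem hoeffding_average {Ω : Type*} [MeasurableSpace Ω] {μ : Measure Ω} [IsProbabilityMeasure μ]
    {n : ℕ} (hn : 0 < n) {X : Fin n → Ω → ℝ} (hX : ∀ i, Measurable (X i)) (hind : iIndepFun X μ)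
    {c κ : ℝ} (hc : ∀ i x, |X i x| ≤ c) (hκ : ∀ i, ∫ x, X i x ∂μ = κ) {ε : ℝ} (hε : 0 ≤ ε) :
    μ.real {x | ε ≤ |(∑ i, X i x) / n - κ|} ≤ 2 * Real.exp (-(n * ε ^ 2 / (2 * c ^ 2))) := by
  have hn' : (0 : ℝ) < n := by exact_mod_cast hn
  have hsub : ∀ i, HasSubgaussianMGF (fun x => X i x - κ) ((‖c - -c‖₊ / 2) ^ 2) μ := fun i => by
    rw [← hκ i]
    exact hasSubgaussianMGF_of_mem_Icc (hX i).aemeasurable (ae_of_all _ fun x => abs_le.1 (hc i x))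
  have hind₁ : iIndepFun (fun i x => X i x - κ) μ :=
    hind.comp (fun _ y => y - κ) fun _ => measurable_id.sub_const κ
  have hind₂ : iIndepFun (fun i x => -(X i x - κ)) μ :=
    hind.comp (fun _ y => -(y - κ)) fun _ => (measurable_id.sub_const κ).neg
  have hexp : -(n * ε) ^ 2 / (2 * ((∑ _i : Fin n, (‖c - -c‖₊ / 2) ^ 2 : NNReal) : ℝ)) =
      -(n * ε ^ 2 / (2 * c ^ 2)) := by
    have h : (‖c - -c‖ / 2) ^ 2 = c ^ 2 := by
      rw [Real.norm_eq_abs, div_pow, sq_abs]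
      ring
    simp only [Finset.sum_const, Finset.card_univ, Fintype.card_fin, nsmul_eq_mul]
    push_cast
    rw [h]
    -- For `c = 0` both exponents are 0 by the convention for division by zero.
    by_cases hc₀ : c = 0
    · simp [hc₀]
    · field_simp
  have h₁ := HasSubgaussianMGF.measure_sum_ge_le_of_iIndepFun hind₁ (s := Finset.univ)
    (fun i _ => hsub i) (mul_nonneg hn'.le hε)
  have h₂ := HasSubgaussianMGF.measure_sum_ge_le_of_iIndepFun hind₂ (s := Finset.univ)
    (fun i _ => (hsub i).neg) (mul_nonneg hn'.le hε)
  rw [hexp] at h₁ h₂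
  have hsum : ∀ x, ∑ i, (X i x - κ) = n * ((∑ i, X i x) / n - κ) := fun x => by
    rw [Finset.sum_sub_distrib, Finset.sum_const, Finset.card_univ, Fintype.card_fin, nsmul_eq_mul]
    field_simp
  have hsubset : {x | ε ≤ |(∑ i, X i x) / n - κ|} ⊆
      {x | n * ε ≤ ∑ i, (X i x - κ)} ∪ {x | n * ε ≤ ∑ i, -(X i x - κ)} := by
    intro x hx
    rw [Set.mem_ofPred_eq, le_abs] at hx
    refine hx.imp (fun h => ?_) (fun h => ?_)
    · rw [Set.mem_ofPred_eq, hsum]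
      exact mul_le_mul_of_nonneg_left h hn'.le
    · rw [Set.mem_ofPred_eq, Finset.sum_neg_distrib, hsum, ← mul_neg]
      exact mul_le_mul_of_nonneg_left h hn'.le
  calc _ ≤ _ := measureReal_mono hsubset
    _ ≤ _ := measureReal_union_le _ _
    _ ≤ _ := by linarith

end Hoeffding

/-! ### Expectation of one uniform sample. -/

section Estimator

instance {V : Type*} (G : SimpleGraph V) : DiscreteMeasurableSpace (SpanningTree G) :=
  ⟨fun _ => trivial⟩

theorem integral_uniform_spanningTree {V : Type*} [Fintype V] {G : SimpleGraph V} {Ω : Type*}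
    [MeasurableSpace Ω] {μ : Measure Ω} {T : Ω → SpanningTree G} (hT : Measurable T)
    (hunif : μ.map T = uniformOn Set.univ) (f : SpanningTree G → ℝ) :
    ∫ x, f (T x) ∂μ = (∑ t, f t) / Fintype.card (SpanningTree G) := by
  rw [← integral_map hT.aemeasurable (by fun_prop), hunif]
  have : IsFiniteMeasure (uniformOn (Set.univ : Set (SpanningTree G))) := by
    unfold uniformOn
    infer_instance
  rw [integral_fintype .of_finite, Finset.sum_div]
  refine Finset.sum_congr rfl fun t _ => ?_
  rw [measureReal_def, uniformOn_univ, Measure.count_singleton]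
  simp [div_eq_inv_mul]

variable {V : Type*} [Fintype V] [DecidableEq V] {G : SimpleGraph V} [DecidableRel G.Adj]
  {v : V} {B : SimpleGraph V} (hB : IsBFSTree G v B)

theorem kemenyEstimate_eq {ω : ℕ} (T : Fin ω → SpanningTree G) :
    kemenyEstimate G v hB T = (∑ i, (sampleX₁ G v hB (T i) - sampleX₂ G v hB (T i))) / ω := by
  rw [kemenyEstimate, Finset.sum_sub_distrib, sub_div, Finset.sum_div, Finset.sum_div]

theorem integral_sample (hG : G.Connected) (s : V) {Ω : Type*} [MeasurableSpace Ω] {μ : Measure Ω}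
    {T : Ω → SpanningTree G} (hT : Measurable T) (hunif : μ.map T = uniformOn Set.univ) :
    ∫ x, (sampleX₁ G v hB (T x) - sampleX₂ G v hB (T x)) ∂μ = (kemeny G s).toReal := by
  have hτ := card_spanningTree_pos hG
  rw [integral_uniform_spanningTree hT hunif fun t => sampleX₁ G v hB t - sampleX₂ G v hB t,
    sum_sampleX₁_sub_sampleX₂ hB hG s]
  field_simp

theorem integrable_sample (hG : G.Connected) {Ω : Type*} [MeasurableSpace Ω] {μ : Measure Ω}
    [IsFiniteMeasure μ] {T : Ω → SpanningTree G} (hT : Measurable T) :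
    Integrable (fun x => sampleX₁ G v hB (T x) - sampleX₂ G v hB (T x)) μ :=
  .of_bound ((Measurable.of_discrete (f := fun t => sampleX₁ G v hB t - sampleX₂ G v hB t)).comp
    hT).aestronglyMeasurable _ (ae_of_all _ fun x => abs_sampleX₁_sub_sampleX₂_le hB hG (T x))

end Estimator

end KemenySpanTree

end

theorem mainTheorem7 {V : Type*} [Fintype V] [DecidableEq V]
    (G : SimpleGraph V) [DecidableRel G.Adj] (hG : G.Connected)
    -- landmark node, breadth-first-search tree with root `v`, source node of Kemeny's constant
    (v : V) (B : SimpleGraph V) (hB : KemenySpanTree.IsBFSTree G v B) (s : V)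
    -- `ω` independent, uniformly distributed random spanning trees
    {Ω : Type*} [MeasurableSpace Ω] (μ : Measure Ω) [IsProbabilityMeasure μ]
    (ω : ℕ) (T : Fin ω → Ω → KemenySpanTree.SpanningTree G)
    (hT_meas : ∀ i, Measurable (T i))
    (hT_unif : ∀ i, μ.map (T i) = uniformOn Set.univ)
    (hT_indep : iIndepFun T μ) :
    KemenySpanTree.kemeny G s ≠ ∞ ∧
    -- each sample is bounded by `2 m Δ_G`
    (∀ T₀ : KemenySpanTree.SpanningTree G,
      |KemenySpanTree.sampleX₁ G v hB T₀ - KemenySpanTree.sampleX₂ G v hB T₀|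
        ≤ 2 * (G.edgeFinset.card : ℝ) * (G.diam : ℝ)) ∧
    -- the estimator is unbiased
    (0 < ω →
      Integrable (fun x => KemenySpanTree.kemenyEstimate G v hB (fun i => T i x)) μ ∧
      ∫ x, KemenySpanTree.kemenyEstimate G v hB (fun i => T i x) ∂μ
        = (KemenySpanTree.kemeny G s).toReal) ∧
    -- the error guarantee
    (∀ ε p_f : ℝ, 0 < ε → 0 < p_f →
      8 * (G.edgeFinset.card : ℝ) ^ 2 * (G.diam : ℝ) ^ 2 * Real.log (2 / p_f) / ε ^ 2 ≤ (ω : ℝ) →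
      1 - p_f ≤ μ.real {x | |KemenySpanTree.kemenyEstimate G v hB (fun i => T i x)
        - (KemenySpanTree.kemeny G s).toReal| ≤ ε}) := by
  have hbound := KemenySpanTree.abs_sampleX₁_sub_sampleX₂_le hB hG
  refine ⟨by rw [KemenySpanTree.kemeny_eq hG]; exact ENNReal.ofReal_ne_top, hbound, ?_, ?_⟩
  · intro hω
    have hω' : (0 : ℝ) < ω := by exact_mod_cast hω
    simp only [KemenySpanTree.kemenyEstimate_eq]
    have hint := fun i => KemenySpanTree.integrable_sample hB hG (μ := μ) (hT_meas i)
    refine ⟨(integrable_finsetSum _ fun i _ => hint i).div_const _, ?_⟩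
    rw [integral_div, integral_finsetSum _ fun i _ => hint i]
    simp only [fun i => KemenySpanTree.integral_sample hB hG s (hT_meas i) (hT_unif i),
      Finset.sum_const, Finset.card_univ, Fintype.card_fin, nsmul_eq_mul]
    field_simp
  · intro ε p_f hε hp hω
    simp only [KemenySpanTree.kemenyEstimate_eq]
    set κ := (KemenySpanTree.kemeny G s).toReal with hκ
    set c : ℝ := 2 * (G.edgeFinset.card : ℝ) * (G.diam : ℝ) with hc
    -- If `c = 0`, the sample-size condition allows `ω = 0`, where Hoeffding is unavailable; but
    -- every sample and κ vanish.
    rcases eq_or_ne c 0 with hc₀ | hc₀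
    · have hzero : ∀ t, KemenySpanTree.sampleX₁ G v hB t - KemenySpanTree.sampleX₂ G v hB t = 0 :=
        fun t => abs_nonpos_iff.1 ((hbound t).trans hc₀.le)
      have hκ₀ : κ = 0 := by
        have h := KemenySpanTree.sum_sampleX₁_sub_sampleX₂ hB hG s
        simp only [hzero, Finset.sum_const_zero] at h
        exact (mul_eq_zero.1 h.symm).resolve_left (KemenySpanTree.card_spanningTree_pos hG).ne'
      simp only [hzero, hκ₀, Finset.sum_const_zero, zero_div, sub_zero, abs_zero, hε.le,
        Set.ofPred_true, probReal_univ]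
      linarith
    rcases le_or_gt 1 p_f with hp₁ | hp₁
    · exact (sub_nonpos.2 hp₁).trans measureReal_nonneg
    have hc2 : 0 < c ^ 2 := by positivity
    have hlog : 0 < Real.log (2 / p_f) := Real.log_pos (by rw [lt_div_iff₀ hp]; linarith)
    -- With `c = 2mΔ` the constant `8m²Δ²` is `2c²`, exactly what makes the Hoeffding bound at most
    -- `p_f`. Since `p_f < 1`, the logarithm is positive, which forces `ω > 0`.
    have hω₁ : 2 * c ^ 2 * Real.log (2 / p_f) / ε ^ 2 ≤ ω := by
      refine le_trans (le_of_eq ?_) hω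
      rw [hc]
      ring
    have hωpos : (0 : ℝ) < ω := lt_of_lt_of_le (by positivity) hω₁
    have hexp : 2 * Real.exp (-(ω * ε ^ 2 / (2 * c ^ 2))) ≤ p_f := by
      have h : Real.log (2 / p_f) ≤ ω * ε ^ 2 / (2 * c ^ 2) := by
        rw [div_le_iff₀ (by positivity)] at hω₁
        rw [le_div_iff₀ (by positivity)]
        linarith
      calc 2 * Real.exp (-(ω * ε ^ 2 / (2 * c ^ 2))) ≤ 2 * Real.exp (-Real.log (2 / p_f)) := by
            gcongr
        _ = p_f := by
            rw [Real.exp_neg, Real.exp_log (by positivity)]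
            field_simp
    have hmeas : Measurable fun t => KemenySpanTree.sampleX₁ G v hB t -
        KemenySpanTree.sampleX₂ G v hB t := .of_discrete
    have hH := KemenySpanTree.hoeffding_average (μ := μ) (by exact_mod_cast hωpos)
      (X := fun i x => KemenySpanTree.sampleX₁ G v hB (T i x) -
        KemenySpanTree.sampleX₂ G v hB (T i x))
      (fun i => hmeas.comp (hT_meas i)) (hT_indep.comp (fun _ => _) fun _ => hmeas)
      (fun i x => hbound (T i x))
      (fun i => KemenySpanTree.integral_sample hB hG s (hT_meas i) (hT_unif i)) hε.le
    set A := {x | |(∑ i, (KemenySpanTree.sampleX₁ G v hB (T i x) -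
      KemenySpanTree.sampleX₂ G v hB (T i x))) / ω - κ| ≤ ε} with hA
    have hcompl : μ.real Aᶜ ≤ p_f := by
      refine (measureReal_mono fun x hx => ?_).trans (hH.trans hexp)
      rw [hA, Set.mem_compl_iff, Set.mem_ofPred_eq, not_le] at hx
      exact hx.le
    -- Subadditivity suffices, so measurability of `A` is not needed.
    have hone : 1 ≤ μ.real A + μ.real Aᶜ := by
      rw [← probReal_univ (μ := μ), ← Set.union_compl_self A]
      exact measureReal_union_le _ _
    linarith
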